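/- For $A,B\in\mathbb{R}^{3\times 3}$ let $\langle A,B\rangle=\sum_{i,j}A_{ij}B_{ij}$ and $\|A\|=\sqrt{\langle A,A\rangle}$. For $F\in\mathrm{GL}^+(3)$ let $V=\sqrt{FF^{\mathsf T}}$ be the left stretch tensor and $\log V\in\mathrm{Sym}(3)$ the Hencky strain. If an objective and isotropic strain energy is written as $W(F)=\widehat W(\log V)$ with $\widehat W:\mathrm{Sym}(3)\to\mathbb{R}$ differentiable, its Cauchy (true) stress is $\sigma(F)=\widehat\sigma(\log V)$ with $\widehat\sigma(X)=e^{-\operatorname{tr}X}\,\mathrm{D}\widehat W(X)$, where $e^{\operatorname{tr}\log V}=\det F$. The elastic response $\widehat\sigma:\mathrm{Sym}(3)\to\mathrm{Sym}(3)$ satisfies TSTS-M$^{++}$ if it is differentiable and $\langle \mathrm{D}\widehat\sigma(X).H,H\rangle>0$ for all $X\in\mathrm{Sym}(3)$ and all $H\in\mathrm{Sym}(3)\setminus\{0\}$. **Proposition.** Let $\alpha\in(0,1)$, $\beta>\tfrac18$, $c\in\mathbb{R}$, and $$W(F)=\frac{\|F\|^{\alpha}}{(\det F)^{\alpha/3}}\exp\bigl(\beta\log^2(\det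 F)\bigr)+c,\qquad F\in\mathrm{GL}^+(3).$$ Then $W(F)=\widehat W(\log V)$ on $\mathrm{GL}^+(3)$ with $\widehat W(X)=W(\exp X)$ differentiable on $\mathrm{Sym}(3)$, and: 1. the elastic response function $\widehat\sigma$ derived from $W$ satisfies TSTS-M$^{++}$; 2. in simple shear $F=\mathbb{1}+\gamma\,e_1\otimes e_2$, $\gamma\in\mathbb{R}$, the Cauchy shear stress is $\sigma_{12}(\gamma)=\alpha(3+\gamma^2)^{\alpha/2-1}\gamma$, and $\gamma\mapsto\sigma_{12}(\gamma)$ is non-monotonic, i.e. neither non-decreasing nor non-increasing on $\mathbb{R}$; 3. $W$ yields a proper elastic law in the infinitesimal theory: $\sigma(\mathbb{1})=0$, and the derivative of $\sigma$ at $F=\mathbb{1}$ is $G\mapsto 2\mu\,\varepsilon+\lambda\operatorname{tr}(\varepsilon)\mathbb{1}$ with $\varepsilon=\tfrac12(G+G^{\mathsf T})$, $\mu=\alpha\,3^{\alpha/2-1}>0$ and $\kappa=\lambda+\tfrac23\mu=2\beta\,3^{\alpha/2}$; in particular $2\mu+3\lambda>0$. Hence $W$ is a compressible strain-energy function that satisfies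 TSTS-M$^{++}$, shows a non-monotonic true-shear-stress response in simple shear, and linearizes to a proper elastic law. -/

import Mathlib

noncomputable section

namespace TrueStressTrueStrain

/-- Second-order tensors in three dimensions. -/
abbrev Mat3 : Type := Matrix (Fin 3) (Fin 3) ℝ

/-- The space `Sym(3)` of symmetric second-order tensors. -/
def Sym3 : Submodule ℝ Mat3 where
  carrier := {A | A.IsSymm}
  add_mem' hA hB := Matrix.IsSymm.add hA hB
  zero_mem' := Matrix.isSymm_zero
  smul_mem' c _ hA := Matrix.IsSymm.smul hA c

/-- The scalar product `⟨A, B⟩ = ∑ᵢⱼ Aᵢⱼ Bᵢⱼ` of second-order tensors. -/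
def tinner (A B : Mat3) : ℝ := ∑ i, ∑ j, A i j * B i j

/-- The norm `‖A‖ = √⟨A, A⟩` of a second-order tensor. -/
def tnorm (A : Mat3) : ℝ := Real.sqrt (tinner A A)

/-- The symmetrized basis tensor `½ (eᵢ ⊗ eⱼ + eⱼ ⊗ eᵢ)`. -/
def symBasis (i j : Fin 3) : Sym3 :=
  ⟨(1 / 2 : ℝ) • (Matrix.single i j (1 : ℝ) + Matrix.single j i (1 : ℝ)), by
    change Matrix.IsSymm _
    rw [Matrix.IsSymm, Matrix.transpose_smul, Matrix.transpose_add, Matrix.transpose_single,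
      Matrix.transpose_single, add_comm]⟩

/-- The gradient of `f : Sym(3) → ℝ` at `X` with respect to `⟨·, ·⟩`: the symmetric tensor that
represents the derivative `D f(X)`, see `tinner_symGrad`. -/
def symGrad (f : Sym3 → ℝ) (X : Sym3) : Sym3 :=
  ⟨Matrix.of fun i j => fderiv ℝ f X (symBasis i j), by
    change Matrix.IsSymm _
    ext i j
    have h : symBasis j i = symBasis i j := by
      apply Subtype.ext
      simp only [symBasis, add_comm]
    simp [h]⟩

theorem sum_symBasis (H : Sym3) : ∑ i, ∑ j, (H : Mat3) i j • symBasis i j = H := by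
  have hs : ∀ i j, (H : Mat3) j i = (H : Mat3) i j := fun i j => Matrix.IsSymm.apply H.2 i j
  have h01 := hs 0 1
  have h02 := hs 0 2
  have h12 := hs 1 2
  apply Subtype.ext
  ext a b
  fin_cases a <;> fin_cases b <;>
    simp [Fin.sum_univ_three, symBasis] <;> linarith

/-- The gradient represents the derivative. -/
theorem tinner_symGrad (f : Sym3 → ℝ) (X H : Sym3) :
    tinner (symGrad f X : Mat3) (H : Mat3) = fderiv ℝ f X H := by
  conv_rhs => rw [← sum_symBasis H]
  simp [tinner, symGrad, map_sum, mul_comm]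

/-- The left stretch tensor `V = √(F Fᵀ)`. -/
def leftStretch (F : Mat3) : Mat3 := cfc Real.sqrt (F * F.transpose)

/-- The Hencky strain `log V`, formed through the spectral decomposition of `V`. -/
def hencky (F : Mat3) : Sym3 :=
  ⟨cfc Real.log (leftStretch F), by
    change Matrix.IsSymm _
    have h : IsSelfAdjoint (cfc Real.log (leftStretch F)) := cfc_predicate Real.log _
    rw [IsSelfAdjoint, Matrix.star_eq_conjTranspose, Matrix.conjTranspose_eq_transpose_of_trivial]
      at h
    exact h⟩

/-- The strain energy as a function of the Hencky strain, `Ŵ(X) = W(exp X)`. For an objective and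
isotropic `W` it is the function with `W(F) = Ŵ(log V)`. -/
def energyOfHencky (W : Mat3 → ℝ) (X : Sym3) : ℝ := W (NormedSpace.exp (X : Mat3))

/-- The Cauchy (true) stress as a function of the Hencky strain,
`σ̂(X) = J⁻¹ D Ŵ(X)` with `J = det (exp X)`. -/
def stressOfHencky (W : Mat3 → ℝ) (X : Sym3) : Sym3 :=
  (Matrix.det (NormedSpace.exp (X : Mat3)))⁻¹ • symGrad (energyOfHencky W) X

/-- The Cauchy (true) stress as a function of the deformation gradient, `σ(F) = σ̂(log V)`. -/
def cauchyStress (W : Mat3 → ℝ) (F : Mat3) : Mat3 := (stressOfHencky W (hencky F) : Mat3)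

/-- TSTS-M⁺⁺ for an elastic response function `σ̂ : Sym(3) → Sym(3)`: it is differentiable
and `⟨D σ̂(X).H, H⟩ > 0` for all `X` and all `H ≠ 0`. -/
def TSTSMpp (σ : Sym3 → Sym3) : Prop :=
  Differentiable ℝ σ ∧
    ∀ X H : Sym3, H ≠ 0 → 0 < tinner (fderiv ℝ σ X H : Mat3) (H : Mat3)

/-- The deformation gradient `1 + γ e₁ ⊗ e₂` of simple shear. -/
def simpleShear (γ : ℝ) : Mat3 := 1 + Matrix.single 0 1 γ

/-- The stress `σ` vanishes at `F = 1`, and its linearization there is the classical isotropic law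
`G ↦ 2μ ε + λ (tr ε) 1` with `ε = ½ (G + Gᵀ)` and the Lamé constants `μ` and `λ`. -/
def LinearizesTo (σ : Mat3 → Mat3) (μ lam : ℝ) : Prop :=
  σ 1 = 0 ∧ ∃ L : Mat3 →L[ℝ] Mat3, HasFDerivAt σ L 1 ∧
    ∀ G : Mat3, L G = (2 * μ) • ((1 / 2 : ℝ) • (G + G.transpose)) +
      (lam * ((1 / 2 : ℝ) • (G + G.transpose)).trace) • (1 : Mat3)

/-- The strain energy `‖F‖^α / (det F)^(α/3) · exp (β log² (det F)) + c`. -/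
def shearEnergy (α β c : ℝ) (F : Mat3) : ℝ :=
  tnorm F ^ α / F.det ^ (α / 3) * Real.exp (β * Real.log F.det ^ 2) + c

end TrueStressTrueStrain

end

/-!
In terms of the Hencky strain `X`, put `t = tr X`, `E = exp (2 X)` and `φ = tr E = ‖exp X‖²`. Since
`det (exp X) = exp t`, the energy is `φ ^ (α / 2) * exp (β t² - α t / 3) + c` (`energyForm`), and
its gradient, divided by `exp t`, is the stress
`exp (β t² - t - α t / 3) (α φ ^ (α / 2 - 1) E + φ ^ (α / 2) (2 β t - α / 3) 1)` (`stressForm`).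
For `X = log V` one has `E = F Fᵀ` and `t = log (det F)`, so that the stress is an explicit function
of `F`, from which the simple shear response and the linearization at `F = 1` are read off.

The derivative of the matrix exponential enters only through a mean value theorem
(`exists_fderiv_exp_eq`): for a continuous linear functional `l`,
`l (D exp(A).H) = l (exp ((1 - s) A) H exp (s A))` for some `s ∈ [0, 1]`. For the trace it gives
`tr (D exp(A).H) = tr (exp(A) H)`. For `⟨·, H⟩` it shows that
`Q = ⟨D(exp (2 X)).H, H⟩` equals `2 ‖P‖²` with `P = exp ((1 - s) X) H exp (s X)`. Hence `Q > 0` for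
`H ≠ 0`, and, as `⟨P, exp X⟩ = ⟨E, H⟩`, the Cauchy-Schwarz inequality yields `φ Q ≥ 2 M²` with
`M = ⟨E, H⟩`.

With `h = tr H` and `u = α M + (2 β t - α / 3) φ h`, the form `⟨D σ̂(X).H, H⟩` is a positive
multiple of `u² - φ h u + 2 β (φ h)² + α (φ Q - 2 M²)`. The first three terms are a quadratic form
in `u` and `φ h` which is positive definite exactly when `β > 1 / 8`, and the last one is
nonnegative. If both `u` and `h` vanish, then `M = 0` and the last term is `α φ Q > 0`
(`quadratic_form_pos`).
-/

namespace TrueStressTrueStrain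

open NormedSpace Topology Filter Set

/-! ### A mean value theorem for the exponential -/

/-- The mean value form of Duhamel's formula
`D exp(A).H = ∫ s in 0..1, exp ((1 - s) A) H exp (s A)`. -/
theorem exists_fderiv_exp_eq {𝔸 : Type*} [NormedRing 𝔸] [NormedAlgebra ℝ 𝔸]
    [CompleteSpace 𝔸] (l : 𝔸 →L[ℝ] ℝ) (A H : 𝔸) :
    ∃ s ∈ Icc (0 : ℝ) 1,
      l (fderiv ℝ exp A H) = l (exp ((1 - s) • A) * H * exp (s • A)) := by
  let +nondep : NormedAlgebra ℚ 𝔸 := .restrictScalars ℚ ℝ 𝔸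
  have hcont : Continuous (exp : 𝔸 → 𝔸) := exp_continuous
  -- For a finite increment `ε • H`, apply the mean value theorem to
  -- `s ↦ l (exp ((1 - s) A) exp (s (A + ε H)))`, which runs from `l (exp A)` to
  -- `l (exp (A + ε H))`.
  have key : ∀ ε : ℝ, ε ≠ 0 → ∃ s ∈ Icc (0 : ℝ) 1,
      l (ε⁻¹ • (exp (A + ε • H) - exp A)) =
        l (exp ((1 - s) • A) * H * exp (s • (A + ε • H))) := by
    intro ε hε
    have hd : ∀ s : ℝ, HasDerivAt
        (fun s : ℝ => l (exp ((1 - s) • A) * exp (s • (A + ε • H))))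
        (ε * l (exp ((1 - s) • A) * H * exp (s • (A + ε • H)))) s := by
      intro s
      have h1 : HasDerivAt (fun s : ℝ => exp ((1 - s) • A)) (-(exp ((1 - s) • A) * A)) s := by
        have := (hasDerivAt_exp_smul_const (𝕂 := ℝ) A (1 - s)).scomp s
          ((hasDerivAt_id s).const_sub 1)
        rwa [neg_one_smul] at this
      have h2 := hasDerivAt_exp_smul_const' (𝕂 := ℝ) (A + ε • H) s
      refine (l.hasFDerivAt.comp_hasDerivAt s (h1.mul h2)).congr_deriv ?_
      rw [← smul_eq_mul ε, ← map_smul]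
      congr 1
      simp only [mul_add, add_mul, neg_mul, mul_assoc, smul_mul_assoc, mul_smul_comm]
      abel
    obtain ⟨s, hs, h⟩ := exists_hasDerivAt_eq_slope _ _ zero_lt_one
      (fun s _ => (hd s).continuousAt.continuousWithinAt) (fun s _ => hd s)
    refine ⟨s, Ioo_subset_Icc_self hs, ?_⟩
    simp only [sub_self, zero_smul, exp_zero, one_mul, sub_zero, one_smul, mul_one, div_one,
      ← map_sub] at h
    rw [map_smul, smul_eq_mul, ← h, inv_mul_cancel_left₀ hε]
  -- Let `ε` tend to `0` along a sequence for which the intermediate points `s` converge.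
  have hε : ∀ n : ℕ, (1 / ((n : ℝ) + 1)) ≠ 0 := fun n => by positivity
  choose s hs hsl using fun n : ℕ => key (1 / ((n : ℝ) + 1)) (hε n)
  obtain ⟨s₀, hs₀, φ, hφ, hlim⟩ := isCompact_Icc.tendsto_subseq hs
  refine ⟨s₀, hs₀, ?_⟩
  have hε0 : Tendsto (fun n => 1 / ((φ n : ℝ) + 1)) atTop (𝓝 0) :=
    tendsto_one_div_add_atTop_nhds_zero_nat.comp hφ.tendsto_atTop
  have hline : HasDerivAt (fun ε : ℝ => exp (A + ε • H)) (fderiv ℝ exp A H) 0 :=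
    (exp_analytic (𝕂 := ℝ) A).differentiableAt.hasFDerivAt.hasLineDerivAt H
  have hslope := hline.tendsto_slope_zero.comp
    (tendsto_nhdsWithin_iff.2 ⟨hε0, Eventually.of_forall fun n => hε (φ n)⟩)
  have hleft := (l.continuous.tendsto _).comp hslope
  have hright : Tendsto (fun n => l (exp ((1 - s (φ n)) • A) * H *
      exp (s (φ n) • (A + (1 / ((φ n : ℝ) + 1)) • H)))) atTop
      (𝓝 (l (exp ((1 - s₀) • A) * H * exp (s₀ • A)))) := by
    have hc : Continuous fun p : ℝ × ℝ =>
        l (exp ((1 - p.1) • A) * H * exp (p.1 • (A + p.2 • H))) := by fun_prop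
    have := (hc.tendsto (s₀, 0)).comp (hlim.prodMk_nhds hε0)
    simpa only [Function.comp_def, zero_smul, add_zero] using this
  refine tendsto_nhds_unique hleft (hright.congr fun n => ?_)
  rw [← hsl]
  simp


/-! ### The scalar product of tensors -/

theorem tinner_eq_trace (A B : Mat3) : tinner A B = (A * B.transpose).trace := by
  simp [tinner, Matrix.trace, Matrix.mul_apply]

theorem tinner_add_left (A B C : Mat3) : tinner (A + B) C = tinner A C + tinner B C := by
  simp [tinner_eq_trace, add_mul]

theorem tinner_smul_left (r : ℝ) (A B : Mat3) : tinner (r • A) B = r * tinner A B := by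
  simp [tinner_eq_trace]

theorem tinner_one_left (A : Mat3) : tinner 1 A = A.trace := by
  simp [tinner_eq_trace]

theorem tinner_self_nonneg (A : Mat3) : 0 ≤ tinner A A :=
  Finset.sum_nonneg fun _ _ => Finset.sum_nonneg fun _ _ => mul_self_nonneg _

theorem tinner_self_pos {A : Mat3} (hA : A ≠ 0) : 0 < tinner A A := by
  refine (tinner_self_nonneg A).lt_of_ne fun h => hA ?_
  rw [tinner_eq_trace, ← Matrix.conjTranspose_eq_transpose_of_trivial] at h
  exact Matrix.trace_mul_conjTranspose_self_eq_zero_iff.1 h.symm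

theorem tinner_sq_le (A B : Mat3) : tinner A B ^ 2 ≤ tinner A A * tinner B B := by
  simp only [tinner, ← Finset.sum_product', Finset.univ_product_univ, ← pow_two]
  exact Finset.sum_mul_sq_le_sq_mul_sq _ _ _

/-! ### Exponentials of symmetric tensors and the Hencky strain -/

theorem isSelfAdjoint_of_isSymm {X : Mat3} (hX : X.IsSymm) : IsSelfAdjoint X := by
  rwa [IsSelfAdjoint, Matrix.star_eq_conjTranspose,
    Matrix.conjTranspose_eq_transpose_of_trivial]

/-- The version of `CFC.real_exp_eq_normedSpace_exp` for real matrices, which carry no canonical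
norm: it is proved by diagonalization. -/
theorem cfc_exp {X : Mat3} (hX : IsSelfAdjoint X) : cfc Real.exp X = exp X := by
  have hX' : X.IsHermitian := hX
  have hU : IsUnit (hX'.eigenvectorUnitary : Mat3) :=
    (Unitary.toUnits hX'.eigenvectorUnitary).isUnit
  have hinv : (hX'.eigenvectorUnitary : Mat3)⁻¹ = star (hX'.eigenvectorUnitary : Mat3) :=
    Matrix.inv_eq_left_inv (Unitary.coe_star_mul_self _)
  conv_rhs => rw [hX'.spectral_theorem]
  rw [hX'.cfc_eq, Matrix.IsHermitian.cfc, Unitary.conjStarAlgAut_apply,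
    Unitary.conjStarAlgAut_apply, ← hinv, Matrix.exp_conj _ _ hU, Matrix.exp_diagonal]
  congr 3
  ext i
  simp [Pi.coe_exp, Real.exp_eq_exp_ℝ]

theorem det_exp_of_isSymm {X : Mat3} (hX : X.IsSymm) :
    (exp X).det = Real.exp X.trace := by
  have hX' : X.IsHermitian := isSelfAdjoint_of_isSymm hX
  rw [← cfc_exp hX', hX'.cfc_eq, Matrix.IsHermitian.cfc, Unitary.conjStarAlgAut_apply,
    Matrix.det_conj_of_mul_eq_one (Unitary.coe_mul_star_self _) (Unitary.coe_star_mul_self _),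
    Matrix.det_diagonal, hX'.trace_eq_sum_eigenvalues]
  simp [Real.exp_sum]

theorem exp_two_smul (X : Mat3) : exp ((2 : ℝ) • X) = exp X * exp X := by
  rw [two_smul, Matrix.exp_add_of_commute _ _ (Commute.refl X)]

theorem transpose_exp_smul {X : Mat3} (hX : X.IsSymm) (r : ℝ) :
    (exp (r • X)).transpose = exp (r • X) :=
  (hX.smul r).exp

theorem leftStretch_mul_self (F : Mat3) : leftStretch F * leftStretch F = F * F.transpose := by
  have hB : (F * F.transpose).PosSemidef := by
    simpa [Matrix.conjTranspose_eq_transpose_of_trivial] using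
      Matrix.posSemidef_self_mul_conjTranspose F
  rw [leftStretch, ← cfc_mul Real.sqrt Real.sqrt _]
  conv_rhs => rw [← cfc_id ℝ (F * F.transpose) hB.1]
  refine cfc_congr fun x hx => ?_
  rw [hB.1.spectrum_real_eq_range_eigenvalues] at hx
  obtain ⟨i, rfl⟩ := hx
  exact Real.mul_self_sqrt (hB.eigenvalues_nonneg i)

/-- The condition on the determinant makes `F Fᵀ` positive definite, so that the logarithm is only
taken of positive eigenvalues of `V`. -/
theorem exp_hencky {F : Mat3} (hF : 0 < F.det) : exp (hencky F : Mat3) = leftStretch F := by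
  have hB : (F * F.transpose).PosDef := by
    rw [← Matrix.conjTranspose_eq_transpose_of_trivial]
    refine Matrix.PosDef.mul_conjTranspose_self F (Matrix.vecMul_injective_iff_isUnit.2 ?_)
    exact (Matrix.isUnit_iff_isUnit_det F).2 hF.ne'.isUnit
  have hsa : IsSelfAdjoint (F * F.transpose) := hB.1
  have hs : ∀ x ∈ spectrum ℝ (F * F.transpose), 0 < Real.sqrt x := by
    intro x hx
    rw [hB.1.spectrum_real_eq_range_eigenvalues] at hx
    obtain ⟨i, rfl⟩ := hx
    exact Real.sqrt_pos.2 (hB.eigenvalues_pos i)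
  have hlog : ContinuousOn Real.log (Real.sqrt '' spectrum ℝ (F * F.transpose)) := by
    refine Real.continuousOn_log.mono ?_
    rintro _ ⟨x, hx, rfl⟩
    exact (hs x hx).ne'
  change exp (cfc Real.log (leftStretch F)) = _
  rw [← cfc_exp (cfc_predicate Real.log _), leftStretch,
    ← cfc_comp Real.log Real.sqrt _ hsa hlog, ← cfc_comp Real.exp _ _ hsa (by fun_prop)
      (hlog.comp (by fun_prop) (mapsTo_image _ _))]
  exact cfc_congr fun x hx => Real.exp_log (hs x hx)

theorem exp_two_smul_hencky {F : Mat3} (hF : 0 < F.det) :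
    exp ((2 : ℝ) • (hencky F : Mat3)) = F * F.transpose := by
  rw [exp_two_smul, exp_hencky hF, leftStretch_mul_self]

theorem trace_hencky {F : Mat3} (hF : 0 < F.det) :
    (hencky F : Mat3).trace = Real.log F.det := by
  have h := det_exp_of_isSymm (hencky F).2
  have h2 := congrArg Matrix.det (leftStretch_mul_self F)
  rw [← exp_hencky hF, Matrix.det_mul, Matrix.det_mul, Matrix.det_transpose, h] at h2
  rw [← (mul_self_inj_of_nonneg (Real.exp_pos _).le hF.le).1 h2, Real.log_exp]

/-! ### The energy and the stress in closed form -/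

/-- The strain energy as a function of `t = log (det F)` and of the left Cauchy-Green tensor
`B = F Fᵀ`; in terms of the Hencky strain `X` these are `t = tr X` and `B = exp (2 X)`. -/
noncomputable def energyForm (α β c t : ℝ) (B : Mat3) : ℝ :=
  B.trace ^ (α / 2) * Real.exp (β * t ^ 2 - α / 3 * t) + c

theorem shearEnergy_eq_energyForm (α β c : ℝ) {F : Mat3} (hF : 0 < F.det) :
    shearEnergy α β c F = energyForm α β c (Real.log F.det) (F * F.transpose) := by
  have h1 : tnorm F ^ α = (F * F.transpose).trace ^ (α / 2) := by
    rw [tnorm, tinner_eq_trace, Real.sqrt_eq_rpow, ← Real.rpow_mul]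
    · congr 1; ring
    · rw [← tinner_eq_trace]; exact tinner_self_nonneg F
  rw [shearEnergy, energyForm, h1, Real.exp_sub, Real.rpow_def_of_pos hF (α / 3),
    mul_comm (Real.log F.det)]
  ring

theorem energyOfHencky_shearEnergy (α β c : ℝ) (X : Sym3) :
    energyOfHencky (shearEnergy α β c) X =
      energyForm α β c (X : Mat3).trace (exp ((2 : ℝ) • (X : Mat3))) := by
  have hd := det_exp_of_isSymm X.2
  have hs : (exp (X : Mat3)).transpose = exp (X : Mat3) := Matrix.IsSymm.exp X.2
  rw [energyOfHencky, shearEnergy_eq_energyForm _ _ _ (hd ▸ Real.exp_pos _), hd, Real.log_exp,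
    exp_two_smul, hs]

/-! ### Derivatives of the closed forms -/

-- Any norm on matrices would do here: only its topology matters.
attribute [local instance] Matrix.linftyOpNormedRing Matrix.linftyOpNormedAlgebra

/-- The trace as a continuous linear functional. -/
noncomputable def traceL : Mat3 →L[ℝ] ℝ :=
  (Matrix.traceLinearMap (Fin 3) ℝ ℝ).toContinuousLinearMap

@[simp] theorem traceL_apply (A : Mat3) : traceL A = A.trace := rfl

/-- The Cauchy stress as a function of `t = log (det F)` and of the left Cauchy-Green tensor
`B = F Fᵀ`, in the variables of `energyForm`. -/
noncomputable def stressForm (α β t : ℝ) (B : Mat3) : Mat3 :=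
  Real.exp (β * t ^ 2 - t - α / 3 * t) •
    ((α * B.trace ^ (α / 2 - 1)) • B + (B.trace ^ (α / 2) * (2 * β * t - α / 3)) • (1 : Mat3))

/-- `t` and `B` are treated as independent variables here. -/
theorem exists_hasFDerivAt_energyForm (α β c t : ℝ) {B : Mat3} (hB : 0 < B.trace) :
    ∃ L : ℝ × Mat3 →L[ℝ] ℝ,
      HasFDerivAt (fun p : ℝ × Mat3 => energyForm α β c p.1 p.2) L (t, B) ∧
      ∀ τ N, L (τ, N) = Real.exp (β * t ^ 2 - α / 3 * t) *
        (α / 2 * B.trace ^ (α / 2 - 1) * N.trace +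
          B.trace ^ (α / 2) * ((2 * β * t - α / 3) * τ)) := by
  have ht : HasFDerivAt (fun p : ℝ × Mat3 => p.1) (ContinuousLinearMap.fst ℝ ℝ Mat3) (t, B) :=
    hasFDerivAt_fst
  have hφ : HasFDerivAt (fun p : ℝ × Mat3 => p.2.trace)
      (traceL.comp (ContinuousLinearMap.snd ℝ ℝ Mat3)) (t, B) :=
    (traceL.comp (ContinuousLinearMap.snd ℝ ℝ Mat3)).hasFDerivAt
  have hp := hφ.rpow_const (p := α / 2) (Or.inl hB.ne')
  have he := (((ht.pow 2).const_mul β).sub (ht.const_mul (α / 3))).exp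
  refine ⟨_, (hp.mul he).add_const c, fun τ N => ?_⟩
  change B.trace ^ (α / 2) * (Real.exp (β * t ^ 2 - α / 3 * t) *
      (β * ((2 • t ^ 1) * τ) - α / 3 * τ)) +
    Real.exp (β * t ^ 2 - α / 3 * t) * ((α / 2 * B.trace ^ (α / 2 - 1)) * N.trace) = _
  rw [two_nsmul]
  ring

theorem exists_hasFDerivAt_stressForm (α β t : ℝ) {B : Mat3} (hB : 0 < B.trace) :
    ∃ L : ℝ × Mat3 →L[ℝ] Mat3,
      HasFDerivAt (fun p : ℝ × Mat3 => stressForm α β p.1 p.2) L (t, B) ∧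
      ∀ τ N, L (τ, N) = ((2 * β * t - 1 - α / 3) * τ) • stressForm α β t B +
        Real.exp (β * t ^ 2 - t - α / 3 * t) •
          ((α * B.trace ^ (α / 2 - 1)) • N +
            (α * ((α / 2 - 1) * B.trace ^ (α / 2 - 1 - 1) * N.trace)) • B +
            (α / 2 * B.trace ^ (α / 2 - 1) * N.trace * (2 * β * t - α / 3) +
              B.trace ^ (α / 2) * (2 * β * τ)) • (1 : Mat3)) := by
  have ht : HasFDerivAt (fun p : ℝ × Mat3 => p.1) (ContinuousLinearMap.fst ℝ ℝ Mat3) (t, B) :=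
    hasFDerivAt_fst
  have hB' : HasFDerivAt (fun p : ℝ × Mat3 => p.2) (ContinuousLinearMap.snd ℝ ℝ Mat3) (t, B) :=
    hasFDerivAt_snd
  have hφ : HasFDerivAt (fun p : ℝ × Mat3 => p.2.trace)
      (traceL.comp (ContinuousLinearMap.snd ℝ ℝ Mat3)) (t, B) :=
    (traceL.comp (ContinuousLinearMap.snd ℝ ℝ Mat3)).hasFDerivAt
  have hp := hφ.rpow_const (p := α / 2) (Or.inl hB.ne')
  have hq := (hφ.rpow_const (p := α / 2 - 1) (Or.inl hB.ne')).const_mul α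
  have he := ((((ht.pow 2).const_mul β).sub ht).sub (ht.const_mul (α / 3))).exp
  have hl := (ht.const_mul (2 * β)).sub_const (α / 3)
  refine ⟨_, he.smul ((hq.smul hB').add ((hp.mul hl).smul_const (1 : Mat3))), fun τ N => ?_⟩
  change Real.exp (β * t ^ 2 - t - α / 3 * t) •
      (((α * B.trace ^ (α / 2 - 1)) • N +
        (α * (((α / 2 - 1) * B.trace ^ (α / 2 - 1 - 1)) * N.trace)) • B) +
      (B.trace ^ (α / 2) * ((2 * β) * τ) +
        (2 * β * t - α / 3) * ((α / 2 * B.trace ^ (α / 2 - 1)) * N.trace)) • (1 : Mat3)) +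
    (Real.exp (β * t ^ 2 - t - α / 3 * t) * (β * ((2 • t ^ 1) * τ) - τ - α / 3 * τ)) •
      ((α * B.trace ^ (α / 2 - 1)) • B +
        (B.trace ^ (α / 2) * (2 * β * t - α / 3)) • (1 : Mat3)) = _
  rw [stressForm, two_nsmul]
  module

/-! ### The derivative of the exponential in the direction of a symmetric tensor -/

theorem exists_trace_fderiv_exp_mul_eq (A H K : Mat3) :
    ∃ s ∈ Icc (0 : ℝ) 1,
      (fderiv ℝ exp A H * K).trace = (exp ((1 - s) • A) * H * exp (s • A) * K).trace :=
  exists_fderiv_exp_eq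
    (Matrix.traceLinearMap (Fin 3) ℝ ℝ ∘ₗ LinearMap.mulRight ℝ K).toContinuousLinearMap A H

/-- The two facts on the derivative of `X ↦ exp (2 X)` that the stress depends on: its trace, and
its pairing with the direction `H` as twice a squared norm. -/
theorem exists_hasFDerivAt_exp_two_smul (X : Sym3) :
    ∃ B' : Sym3 →L[ℝ] Mat3,
      HasFDerivAt (fun Y : Sym3 => exp ((2 : ℝ) • (Y : Mat3))) B' X ∧
      (∀ H : Sym3, (B' H).trace = 2 * tinner (exp ((2 : ℝ) • (X : Mat3))) H) ∧
      ∀ H : Sym3, ∃ s : ℝ, ∃ P : Mat3,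
        P = exp ((1 - s) • (X : Mat3)) * H * exp (s • (X : Mat3)) ∧
        tinner (B' H) H = 2 * tinner P P := by
  set D := fderiv ℝ exp ((2 : ℝ) • (X : Mat3))
  have h1 : HasFDerivAt exp D ((2 : ℝ) • (X : Mat3)) :=
    (exp_analytic (𝕂 := ℝ) ((2 : ℝ) • (X : Mat3))).differentiableAt.hasFDerivAt
  have h2 : HasFDerivAt (fun Y : Sym3 => (2 : ℝ) • (Y : Mat3)) ((2 : ℝ) • Sym3.subtypeL) X :=
    Sym3.subtypeL.hasFDerivAt.const_smul (2 : ℝ)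
  have key : ∀ H : Sym3, ∀ K : Mat3, ∃ s : ℝ,
      ((D.comp ((2 : ℝ) • Sym3.subtypeL)) H * K).trace =
        2 * (exp ((1 - s) • (X : Mat3)) * exp ((1 - s) • (X : Mat3)) * H *
          (exp (s • (X : Mat3)) * exp (s • (X : Mat3))) * K).trace := by
    intro H K
    obtain ⟨s, -, hs⟩ :=
      exists_trace_fderiv_exp_mul_eq ((2 : ℝ) • (X : Mat3)) ((2 : ℝ) • (H : Mat3)) K
    refine ⟨s, hs.trans ?_⟩
    rw [smul_comm _ (2 : ℝ), smul_comm _ (2 : ℝ), exp_two_smul, exp_two_smul]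
    simp only [mul_smul_comm, smul_mul_assoc, Matrix.trace_smul, smul_eq_mul]
  refine ⟨D.comp ((2 : ℝ) • Sym3.subtypeL), h1.comp X h2, fun H => ?_, fun H => ?_⟩
  · have hH : (H : Mat3).transpose = H := H.2
    obtain ⟨s, hs⟩ := key H 1
    rw [mul_one, mul_one] at hs
    rw [hs, tinner_eq_trace, hH, Matrix.trace_mul_cycle, ← exp_two_smul, ← exp_two_smul,
      ← Matrix.exp_add_of_commute]
    · rw [← smul_add, ← add_smul, add_sub_cancel, one_smul]
    · exact (((Commute.refl _).smul_left s).smul_right (1 - s)).smul_left 2 |>.smul_right 2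
  · have hH : (H : Mat3).transpose = H := H.2
    obtain ⟨s, hs⟩ := key H H
    refine ⟨s, _, rfl, ?_⟩
    rw [tinner_eq_trace, hH, hs, tinner_eq_trace, Matrix.transpose_mul, Matrix.transpose_mul,
      transpose_exp_smul X.2, transpose_exp_smul X.2, hH]
    congr 1
    simp only [mul_assoc]
    rw [Matrix.trace_mul_comm]
    simp only [mul_assoc]

/-! ### The gradient of the energy -/

theorem trace_exp_two_smul_pos (X : Sym3) : 0 < (exp ((2 : ℝ) • (X : Mat3))).trace := by
  have h := tinner_self_pos (Matrix.isUnit_exp (X : Mat3)).ne_zero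
  have hs : (exp (X : Mat3)).transpose = exp (X : Mat3) := Matrix.IsSymm.exp X.2
  rwa [tinner_eq_trace, hs, ← exp_two_smul] at h

theorem hasFDerivAt_trace (X : Sym3) :
    HasFDerivAt (fun Y : Sym3 => (Y : Mat3).trace) (traceL.comp Sym3.subtypeL) X :=
  (traceL.comp Sym3.subtypeL).hasFDerivAt

theorem tinner_symBasis {A : Mat3} (hA : A.IsSymm) (i j : Fin 3) :
    tinner A (symBasis i j) = A i j := by
  have h : A j i = A i j := hA.apply i j
  rw [tinner_eq_trace]
  simp [symBasis, mul_add, Matrix.trace_add, Matrix.trace_mul_single, h]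
  ring

theorem exists_hasFDerivAt_energyOfHencky (α β c : ℝ) (X : Sym3) :
    ∃ L : Sym3 →L[ℝ] ℝ, HasFDerivAt (energyOfHencky (shearEnergy α β c)) L X ∧
      ∀ H : Sym3, L H = Real.exp (X : Mat3).trace *
        tinner (stressForm α β (X : Mat3).trace (exp ((2 : ℝ) • (X : Mat3)))) H := by
  obtain ⟨B', hB', htr, -⟩ := exists_hasFDerivAt_exp_two_smul X
  obtain ⟨L, hL, hLH⟩ := exists_hasFDerivAt_energyForm α β c (X : Mat3).trace
    (trace_exp_two_smul_pos X)
  refine ⟨L.comp ((traceL.comp Sym3.subtypeL).prod B'), ?_, fun H => ?_⟩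
  · rw [funext (energyOfHencky_shearEnergy α β c)]
    exact hL.comp X ((hasFDerivAt_trace X).prodMk hB')
  · have h : Real.exp (β * (X : Mat3).trace ^ 2 - α / 3 * (X : Mat3).trace) =
        Real.exp (X : Mat3).trace *
          Real.exp (β * (X : Mat3).trace ^ 2 - (X : Mat3).trace - α / 3 * (X : Mat3).trace) := by
      rw [← Real.exp_add]
      congr 1
      ring
    refine (hLH (H : Mat3).trace (B' H)).trans ?_
    rw [stressForm, tinner_smul_left, tinner_add_left, tinner_smul_left, tinner_smul_left,
      tinner_one_left, htr, h]
    ring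

theorem coe_stressOfHencky (α β c : ℝ) (X : Sym3) :
    (stressOfHencky (shearEnergy α β c) X : Mat3) =
      stressForm α β (X : Mat3).trace (exp ((2 : ℝ) • (X : Mat3))) := by
  obtain ⟨L, hL, hLH⟩ := exists_hasFDerivAt_energyOfHencky α β c X
  have hsymm : (stressForm α β (X : Mat3).trace (exp ((2 : ℝ) • (X : Mat3)))).IsSymm :=
    ((((X.2.smul (2 : ℝ)).exp).smul _).add (Matrix.isSymm_one.smul _)).smul _
  ext i j
  change (Matrix.det (exp (X : Mat3)))⁻¹ *
    fderiv ℝ (energyOfHencky (shearEnergy α β c)) X (symBasis i j) = _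
  have hf : fderiv ℝ (energyOfHencky (shearEnergy α β c)) X = L := hL.fderiv
  rw [hf, hLH, det_exp_of_isSymm X.2, inv_mul_cancel_left₀ (Real.exp_pos _).ne',
    tinner_symBasis hsymm]

theorem cauchyStress_shearEnergy (α β c : ℝ) {F : Mat3} (hF : 0 < F.det) :
    cauchyStress (shearEnergy α β c) F = stressForm α β (Real.log F.det) (F * F.transpose) := by
  rw [cauchyStress, coe_stressOfHencky, trace_hencky hF, exp_two_smul_hencky hF]

/-! ### Positivity of the derivative of the stress -/

/-- The first three terms form a quadratic form in `u` and `φ * h` of discriminant `1 - 8 * β`. -/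
theorem quadratic_form_pos {α β φ Q M h u : ℝ} (hα : 0 < α) (hβ : 1 / 8 < β) (hφ : 0 < φ)
    (hQ : 0 < Q) (hM : 2 * M ^ 2 ≤ φ * Q) (hu : h = 0 → u = α * M) :
    0 < u ^ 2 - φ * h * u + 2 * β * (φ * h) ^ 2 + α * (φ * Q - 2 * M ^ 2) := by
  have hsq : u ^ 2 - φ * h * u + 2 * β * (φ * h) ^ 2 =
      (u - φ * h / 2) ^ 2 + (2 * β - 1 / 4) * (φ * h) ^ 2 := by ring
  have hαM : 0 ≤ α * (φ * Q - 2 * M ^ 2) := mul_nonneg hα.le (by linarith)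
  rw [hsq]
  by_cases hh : h = 0
  · rw [hu hh, hh]
    by_cases hM0 : M = 0
    · have := mul_pos hα (mul_pos hφ hQ)
      simpa [hM0] using this
    · have : 0 < (α * M) ^ 2 := by positivity
      simpa using add_pos_of_pos_of_nonneg this hαM
  · have : 0 < (2 * β - 1 / 4) * (φ * h) ^ 2 := mul_pos (by linarith) (by positivity)
    have := sq_nonneg (u - φ * h / 2)
    linarith

/-- The projection `A ↦ ½ (A + Aᵀ)` onto `Sym(3)`. It transfers differentiability of a map from
`Mat3`-valued to `Sym3`-valued. -/
noncomputable def symPart : Mat3 →L[ℝ] Sym3 :=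
  LinearMap.toContinuousLinearMap
    { toFun := fun A => ⟨(1 / 2 : ℝ) • (A + A.transpose), by
        change Matrix.IsSymm _
        rw [Matrix.IsSymm, Matrix.transpose_smul, Matrix.transpose_add,
          Matrix.transpose_transpose, add_comm]⟩
      map_add' := fun A B => Subtype.ext <| by
        change (1 / 2 : ℝ) • (A + B + (A + B).transpose) =
          (1 / 2 : ℝ) • (A + A.transpose) + (1 / 2 : ℝ) • (B + B.transpose)
        rw [Matrix.transpose_add]
        module
      map_smul' := fun r A => Subtype.ext <| by
        change (1 / 2 : ℝ) • (r • A + (r • A).transpose) =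
          r • (1 / 2 : ℝ) • (A + A.transpose)
        rw [Matrix.transpose_smul]
        module }

theorem symPart_coe (X : Sym3) : symPart X = X := by
  have hX : (X : Mat3).transpose = X := X.2
  apply Subtype.ext
  change (1 / 2 : ℝ) • ((X : Mat3) + (X : Mat3).transpose) = X
  rw [hX]
  module

/-- The Cauchy-Schwarz inequality for `P` and `exp X`, as `⟨P, exp X⟩ = ⟨exp (2 X), H⟩` and
`‖exp X‖² = tr (exp (2 X))`. -/
theorem tinner_exp_sq_le {X H : Mat3} (hX : X.IsSymm) (hH : H.IsSymm) (s : ℝ) {P : Mat3}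
    (hP : P = exp ((1 - s) • X) * H * exp (s • X)) :
    tinner (exp ((2 : ℝ) • X)) H ^ 2 ≤ tinner P P * (exp ((2 : ℝ) • X)).trace := by
  have hE : (exp X).transpose = exp X := hX.exp
  have hE2 : (exp ((2 : ℝ) • X)).transpose = exp ((2 : ℝ) • X) := transpose_exp_smul hX 2
  have h1 : tinner P (exp X) = tinner (exp ((2 : ℝ) • X)) H := by
    have hc : exp (s • X) * exp X * exp ((1 - s) • X) = exp ((2 : ℝ) • X) := by
      rw [← Matrix.exp_add_of_commute _ _ ((Commute.refl X).smul_left s),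
        ← Matrix.exp_add_of_commute]
      · congr 1
        module
      · exact (((Commute.refl X).smul_left s).add_left (Commute.refl X)).smul_right (1 - s)
    have hH' : H.transpose = H := hH
    rw [tinner_eq_trace, tinner_eq_trace, hE, hH', hP, ← hc]
    simp only [mul_assoc]
    rw [Matrix.trace_mul_comm]
    simp only [mul_assoc]
    rw [Matrix.trace_mul_comm]
    simp only [mul_assoc]
  have h2 : tinner (exp X) (exp X) = (exp ((2 : ℝ) • X)).trace := by
    rw [tinner_eq_trace, hE, exp_two_smul]
  rw [← h1, ← h2]
  exact tinner_sq_le P (exp X)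

theorem tinner_mul_mul_exp_pos {X H : Mat3} (hH : H ≠ 0) (s : ℝ) {P : Mat3}
    (hP : P = exp ((1 - s) • X) * H * exp (s • X)) : 0 < tinner P P := by
  refine tinner_self_pos fun h0 => hH ?_
  rw [hP, (Matrix.isUnit_exp (s • X)).mul_left_eq_zero,
    (Matrix.isUnit_exp ((1 - s) • X)).mul_right_eq_zero] at h0
  exact h0

theorem tstsMpp_stressOfHencky {α β : ℝ} (c : ℝ) (hα : 0 < α) (hβ : 1 / 8 < β) :
    TSTSMpp (stressOfHencky (shearEnergy α β c)) := by
  have key : ∀ X : Sym3, DifferentiableAt ℝ (stressOfHencky (shearEnergy α β c)) X ∧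
      ∀ H : Sym3, H ≠ 0 →
        0 < tinner (fderiv ℝ (stressOfHencky (shearEnergy α β c)) X H : Mat3) H := by
    intro X
    obtain ⟨B', hB', htr, hQ⟩ := exists_hasFDerivAt_exp_two_smul X
    have hφ := trace_exp_two_smul_pos X
    obtain ⟨L, hL, hLH⟩ := exists_hasFDerivAt_stressForm α β (X : Mat3).trace hφ
    have hcoe : HasFDerivAt (fun Y : Sym3 => (stressOfHencky (shearEnergy α β c) Y : Mat3))
        (L.comp ((traceL.comp Sym3.subtypeL).prod B')) X := by
      rw [funext (coe_stressOfHencky α β c)]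
      exact hL.comp X ((hasFDerivAt_trace X).prodMk hB')
    have hdiff : DifferentiableAt ℝ (stressOfHencky (shearEnergy α β c)) X := by
      have h := (symPart.hasFDerivAt.comp X hcoe).differentiableAt
      have he : (symPart ∘ fun Y : Sym3 => (stressOfHencky (shearEnergy α β c) Y : Mat3)) =
          stressOfHencky (shearEnergy α β c) := funext fun Y => symPart_coe _
      rwa [he] at h
    refine ⟨hdiff, fun H hH => ?_⟩
    have hval : (fderiv ℝ (stressOfHencky (shearEnergy α β c)) X H : Mat3) =
        L ((H : Mat3).trace, B' H) :=
      DFunLike.congr_fun ((Sym3.subtypeL.hasFDerivAt.comp X hdiff.hasFDerivAt).unique hcoe) H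
    obtain ⟨s, P, hP, hBH⟩ := hQ H
    have hH0 : (H : Mat3) ≠ 0 := fun h => hH (Subtype.ext h)
    have hPpos := tinner_mul_mul_exp_pos hH0 s hP
    have hCS := tinner_exp_sq_le X.2 H.2 s hP
    rw [hval, hLH, htr H]
    simp only [stressForm, tinner_add_left, tinner_smul_left, tinner_one_left, hBH]
    set φ := (exp ((2 : ℝ) • (X : Mat3))).trace
    set t := (X : Mat3).trace
    set h := (H : Mat3).trace
    set M := tinner (exp ((2 : ℝ) • (X : Mat3))) H
    -- All powers of `φ` are expressed through the smallest one.
    have hr : 0 < φ ^ (α / 2 - 1 - 1) := Real.rpow_pos_of_pos hφ _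
    have h1 : φ ^ (α / 2 - 1) = φ * φ ^ (α / 2 - 1 - 1) := by
      rw [Real.rpow_sub_one hφ.ne' (α / 2 - 1), mul_div_cancel₀ _ hφ.ne']
    have h2 : φ ^ (α / 2) = φ * φ ^ (α / 2 - 1) := by
      rw [Real.rpow_sub_one hφ.ne' (α / 2), mul_div_cancel₀ _ hφ.ne']
    rw [h2, h1]
    have hpos := quadratic_form_pos (h := h) (u := α * M + (2 * β * t - α / 3) * (φ * h))
      hα hβ hφ (mul_pos two_pos hPpos) (by linarith : 2 * M ^ 2 ≤ φ * (2 * tinner P P))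
      (fun hh => by rw [hh]; ring)
    refine (mul_pos (mul_pos (Real.exp_pos (β * t ^ 2 - t - α / 3 * t)) hr) hpos).trans_eq ?_
    ring
  exact ⟨fun X => (key X).1, fun X => (key X).2⟩

/-! ### Simple shear -/

theorem cauchyStress_simpleShear (α β c γ : ℝ) :
    cauchyStress (shearEnergy α β c) (simpleShear γ) 0 1 =
      α * (3 + γ ^ 2) ^ (α / 2 - 1) * γ := by
  have hdet : (simpleShear γ).det = 1 := by
    simp [simpleShear, Matrix.det_fin_three, Matrix.single]
  have htr : (simpleShear γ * (simpleShear γ).transpose).trace = 3 + γ ^ 2 := by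
    simp [simpleShear, Matrix.trace, Matrix.mul_apply, Fin.sum_univ_three, Matrix.single,
      Matrix.one_apply]
    ring
  have h01 : (simpleShear γ * (simpleShear γ).transpose) 0 1 = γ := by
    simp [simpleShear, Matrix.mul_apply, Matrix.single, Matrix.one_apply]
  rw [cauchyStress_shearEnergy α β c (hdet ▸ one_pos), hdet, Real.log_one, stressForm, htr]
  simp [h01]

/-- For large `γ` the shear stress is at most `α * γ ^ (α - 1)`. This is where `α < 1` enters. -/
theorem tendsto_shearStress_atTop {α : ℝ} (hα0 : 0 < α) (hα1 : α < 1) :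
    Tendsto (fun γ : ℝ => α * (3 + γ ^ 2) ^ (α / 2 - 1) * γ) atTop (𝓝 0) := by
  have hlim : Tendsto (fun γ : ℝ => α * γ ^ (-(1 - α))) atTop (𝓝 0) := by
    simpa using (tendsto_rpow_neg_atTop (sub_pos.2 hα1)).const_mul α
  refine tendsto_of_tendsto_of_tendsto_of_le_of_le' tendsto_const_nhds hlim ?_ ?_
  · filter_upwards [eventually_gt_atTop 0] with γ hγ
    positivity
  · filter_upwards [eventually_gt_atTop 0] with γ hγ
    have h : (3 + γ ^ 2) ^ (α / 2 - 1) ≤ (γ ^ 2) ^ (α / 2 - 1) :=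
      Real.rpow_le_rpow_of_nonpos (by positivity) (by linarith) (by linarith)
    calc α * (3 + γ ^ 2) ^ (α / 2 - 1) * γ ≤ α * (γ ^ 2) ^ (α / 2 - 1) * γ := by gcongr
      _ = α * γ ^ (-(1 - α)) := by
        rw [← Real.rpow_natCast γ 2, ← Real.rpow_mul hγ.le, mul_assoc, ← Real.rpow_add_one hγ.ne']
        congr 2
        push_cast
        ring

theorem not_monotone_shearStress {α : ℝ} (hα0 : 0 < α) (hα1 : α < 1) :
    ¬ Monotone fun γ : ℝ => α * (3 + γ ^ 2) ^ (α / 2 - 1) * γ := by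
  intro hmono
  have h := hmono.ge_of_tendsto (tendsto_shearStress_atTop hα0 hα1) 1
  have : 0 < α * (3 + (1 : ℝ) ^ 2) ^ (α / 2 - 1) * 1 := by positivity
  exact this.not_ge h

theorem not_antitone_shearStress {α : ℝ} (hα0 : 0 < α) :
    ¬ Antitone fun γ : ℝ => α * (3 + γ ^ 2) ^ (α / 2 - 1) * γ := by
  intro hanti
  have h := hanti (zero_le_one (α := ℝ))
  have : 0 < α * (3 + (1 : ℝ) ^ 2) ^ (α / 2 - 1) * 1 := by positivity
  simp only [mul_zero] at h
  exact this.not_ge h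

/-! ### Linearization at the identity -/

theorem hasFDerivAt_det_one : HasFDerivAt (fun F : Mat3 => F.det) traceL 1 := by
  have he : ∀ i j, HasFDerivAt (fun F : Mat3 => F i j)
      (Matrix.entryLinearMap ℝ ℝ i j).toContinuousLinearMap (1 : Mat3) := fun i j =>
    (Matrix.entryLinearMap ℝ ℝ i j).toContinuousLinearMap.hasFDerivAt
  simp only [Matrix.det_fin_three]
  refine HasFDerivAt.congr_fderiv
    (((((((he 0 0).mul (he 1 1)).mul (he 2 2)).sub
      (((he 0 0).mul (he 1 2)).mul (he 2 1))).sub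
      (((he 0 1).mul (he 1 0)).mul (he 2 2))).add
      (((he 0 1).mul (he 1 2)).mul (he 2 0))).add
      (((he 0 2).mul (he 1 0)).mul (he 2 1)) |>.sub
      (((he 0 2).mul (he 1 1)).mul (he 2 0))) ?_
  refine ContinuousLinearMap.ext fun G => ?_
  simp only [Pi.mul_apply, Matrix.one_apply_eq, ne_eq, Fin.reduceEq, not_false_eq_true,
    Matrix.one_apply_ne, mul_one, mul_zero]
  -- the product rule for the six terms of the determinant, evaluated at the identity
  change 1 * G 2 2 + 1 * (1 * G 1 1 + 1 * G 0 0) - (0 * G 2 1 + 0 * (1 * G 1 2 + 0 * G 0 0)) -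
      (0 * G 2 2 + 1 * (0 * G 1 0 + 0 * G 0 1)) + (0 * G 2 0 + 0 * (0 * G 1 2 + 0 * G 0 1)) +
      (0 * G 2 1 + 0 * (0 * G 1 0 + 0 * G 0 2)) - (0 * G 2 0 + 0 * (0 * G 1 1 + 1 * G 0 2)) =
    G.trace
  rw [Matrix.trace_fin_three]
  ring

/-- The second modulus is `λ = κ - 2 μ / 3` with `κ = 2 β 3 ^ (α / 2)`. -/
theorem linearizesTo_cauchyStress (α β c : ℝ) :
    LinearizesTo (cauchyStress (shearEnergy α β c)) (α * 3 ^ (α / 2 - 1))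
      (2 * β * 3 ^ (α / 2) - 2 / 3 * (α * 3 ^ (α / 2 - 1))) := by
  have h3 : (3 : ℝ) ^ (α / 2) = 3 * 3 ^ (α / 2 - 1) := by
    rw [Real.rpow_sub_one three_ne_zero, mul_div_cancel₀ _ three_ne_zero]
  have h3' : (3 : ℝ) ^ (α / 2 - 1) = 3 * 3 ^ (α / 2 - 1 - 1) := by
    rw [Real.rpow_sub_one three_ne_zero (α / 2 - 1), mul_div_cancel₀ _ three_ne_zero]
  have htr1 : (1 : Mat3).trace = 3 := by simp
  have hzero : stressForm α β 0 1 = 0 := by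
    rw [stressForm, htr1, h3, ← add_smul]
    ring_nf
    simp
  refine ⟨?_, ?_⟩
  · rw [cauchyStress_shearEnergy α β c (by simp)]
    simpa using hzero
  have ht : HasFDerivAt (fun F : Mat3 => Real.log F.det) traceL 1 := by
    refine (hasFDerivAt_det_one.log (by simp)).congr_fderiv (ContinuousLinearMap.ext fun G => ?_)
    change (1 : Mat3).det⁻¹ * G.trace = G.trace
    simp
  let T : Mat3 →L[ℝ] Mat3 :=
    (Matrix.transposeLinearEquiv (Fin 3) (Fin 3) ℝ ℝ).toLinearMap.toContinuousLinearMap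
  have hT : HasFDerivAt (fun F : Mat3 => F.transpose) T 1 := T.hasFDerivAt
  have hB := (hasFDerivAt_id (𝕜 := ℝ) (1 : Mat3)).mul' hT
  obtain ⟨L, hL, hLH⟩ := exists_hasFDerivAt_stressForm α β 0 (B := 1) (htr1 ▸ three_pos)
  have hL' : HasFDerivAt (fun p : ℝ × Mat3 => stressForm α β p.1 p.2) L
      (Real.log (1 : Mat3).det, (1 : Mat3) * (1 : Mat3).transpose) := by simpa using hL
  refine ⟨L.comp (traceL.prod _), (hL'.comp (1 : Mat3) (ht.prodMk hB)).congr_of_eventuallyEq ?_,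
    fun G => ?_⟩
  · have hpos : ∀ᶠ F : Mat3 in 𝓝 1, 0 < F.det :=
      hasFDerivAt_det_one.continuousAt.eventually (lt_mem_nhds (by simp))
    filter_upwards [hpos] with F hF using cauchyStress_shearEnergy α β c hF
  · refine (hLH G.trace ((1 : Mat3) * G.transpose + G * (1 : Mat3).transpose)).trans ?_
    rw [hzero, htr1, h3, h3']
    simp
    module

end TrueStressTrueStrain

open TrueStressTrueStrain in
theorem mainTheorem4 (α β c : ℝ) (hα0 : 0 < α) (hα1 : α < 1) (hβ : 1 / 8 < β) :
    -- the energy is a differentiable function of the Hencky strain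
    (∀ F : TrueStressTrueStrain.Mat3, 0 < F.det →
      TrueStressTrueStrain.shearEnergy α β c F =
        TrueStressTrueStrain.energyOfHencky (TrueStressTrueStrain.shearEnergy α β c)
          (TrueStressTrueStrain.hencky F)) ∧
    Differentiable ℝ
      (TrueStressTrueStrain.energyOfHencky (TrueStressTrueStrain.shearEnergy α β c)) ∧
    -- TSTS-M⁺⁺
    TrueStressTrueStrain.TSTSMpp
      (TrueStressTrueStrain.stressOfHencky (TrueStressTrueStrain.shearEnergy α β c)) ∧
    -- the Cauchy shear stress in simple shear, and its lack of monotonicity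
    (∀ γ : ℝ, TrueStressTrueStrain.cauchyStress (TrueStressTrueStrain.shearEnergy α β c)
        (TrueStressTrueStrain.simpleShear γ) 0 1 =
      α * (3 + γ ^ 2) ^ (α / 2 - 1) * γ) ∧
    (¬ Monotone fun γ : ℝ =>
      TrueStressTrueStrain.cauchyStress (TrueStressTrueStrain.shearEnergy α β c)
        (TrueStressTrueStrain.simpleShear γ) 0 1) ∧
    (¬ Antitone fun γ : ℝ =>
      TrueStressTrueStrain.cauchyStress (TrueStressTrueStrain.shearEnergy α β c)
        (TrueStressTrueStrain.simpleShear γ) 0 1) ∧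
    -- a proper linear elastic law in the infinitesimal theory
    (∃ μ lam : ℝ,
      TrueStressTrueStrain.LinearizesTo
        (TrueStressTrueStrain.cauchyStress (TrueStressTrueStrain.shearEnergy α β c)) μ lam ∧
      μ = α * 3 ^ (α / 2 - 1) ∧ lam + 2 / 3 * μ = 2 * β * 3 ^ (α / 2) ∧
      0 < μ ∧ 0 < 2 * μ + 3 * lam) := by
  refine ⟨fun F hF => ?_, fun X => ?_, tstsMpp_stressOfHencky c hα0 hβ,
    cauchyStress_simpleShear α β c, ?_, ?_, _, _, linearizesTo_cauchyStress α β c, rfl, ?_, ?_, ?_⟩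
  · rw [shearEnergy_eq_energyForm α β c hF, energyOfHencky_shearEnergy, trace_hencky hF,
      exp_two_smul_hencky hF]
  · obtain ⟨L, hL, -⟩ := exists_hasFDerivAt_energyOfHencky α β c X
    exact hL.differentiableAt
  · simpa only [cauchyStress_simpleShear] using not_monotone_shearStress hα0 hα1
  · simpa only [cauchyStress_simpleShear] using not_antitone_shearStress hα0
  · ring
  · positivity
  · -- the combination `2 μ + 3 λ` is three times the bulk modulus
    have h : 0 < 3 * (2 * β * (3 : ℝ) ^ (α / 2)) := by
      have : 0 < β := by linarith
      positivity
    linarith
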